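/- Let $E$ be a set and identify a bipartition $(A, E\setminus A)$ of $E$ with the subset $A$. Two subsets $A,B$ of $E$ are \emph{nested} if $A\subseteq B$, $B\subseteq A$, $A\cap B=\emptyset$ or $A\cup B=E$; otherwise they \emph{cross}. Let $\mathcal{B}$ be a set of subsets of $E$, each different from $\emptyset$ and $E$, such that $\mathcal{B}$ is closed under complements and such that $S\cup T\in\mathcal{B}$ for all crossing $S,T\in\mathcal{B}$. Let $\mathcal{E}$ be the set of elements of $\mathcal{B}$ that cross no element of $\mathcal{B}$, and let $\mathcal{V}$ be the finest partition of $\mathcal{B}\setminus\mathcal{E}$ such that elements of distinct partition classes are nested. For a set $S$ of subsets of $E$ let $\partial(S)$ be the set of equivalence classes of the relation on $E$ under which $e$ and $f$ are equivalent if every $A\in S$ contains either both or neither of $e,f$. Let the \emph{closure} $\mathrm{cl}(S)$ be the set of those elements of $\mathcal{B}$ that are unions of elements of $\partial(S)$. An \emph{interval} of a cyclically ordered set $X$ is a subset that contains, with any two of its points $x,y$, all points strictly between $x$ and $y$ or all points strictly between $y$ and $x$; it is \emph{non-trivial} if it is neither $\emptyset$ nor $X$. (All cyclic orders are total.) A \emph{pre-flower}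 is a finite subset $\mathcal{F}$ of $\mathcal{B}$ with at least two elements such that for all $S,T\in\mathcal{F}$ there are $R_0,\dots,R_n\in\mathcal{F}$ with $R_0=S$, $R_n=T$ such that $R_i$ and $R_{i+1}$ cross for $0\le i\le n-1$. A \emph{pre-daisy} is a pre-flower $\mathcal{F}$ for which there is a cyclic order on $\partial(\mathcal{F})$ such that the elements of $\mathrm{cl}(\mathcal{F})$ are exactly the unions of non-trivial intervals of $\partial(\mathcal{F})$. Let $V\in\mathcal{V}$ be such that every pre-flower $\mathcal{F}\subseteq V$ is a pre-daisy. Then there is a cyclic order on $\partial(V)$ such that every element of $\mathrm{cl}(V)$ is the union of an interval of $\partial(V)$, and this cyclic order is unique up to mirroring: every cyclic order on $\partial(V)$ with this property equals it or its reverse. -/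

import Mathlib

/-! A bipartition `(A, E \ A)` of the ground set `E` is represented by its first side `A : Set E`;
the inverse of `A` is `Aᶜ`. -/

namespace BipartitionSystem

variable {E : Type*}

/-- Two (oriented) bipartitions are nested if some orientations of them are comparable. -/
def Nested (A B : Set E) : Prop :=
  A ⊆ B ∨ A ∩ B = ∅ ∨ B ⊆ A ∨ A ∪ B = Set.univ

/-- Two bipartitions cross if they are not nested. -/
def Crosses (A B : Set E) : Prop := ¬ Nested A B

/-- The elements of `𝓑` that cross no element of `𝓑`. -/
def uncrossed (𝓑 : Set (Set E)) : Set (Set E) :=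
  {S | S ∈ 𝓑 ∧ ∀ T ∈ 𝓑, Nested S T}

/-- The finest equivalence relation on the elements of `𝓑` that cross some element of `𝓑` such that
crossing elements are equivalent. (In the order on `Setoid`, finer relations are smaller.) -/
def crossingSetoid (𝓑 : Set (Set E)) : Setoid ↥(𝓑 \ uncrossed 𝓑) :=
  sInf {r | ∀ S T : ↥(𝓑 \ uncrossed 𝓑), Crosses (S : Set E) (T : Set E) → r S T}

/-- The finest partition of `𝓑 \ uncrossed 𝓑` such that elements of distinct partition classes are
nested; its elements are the crossing classes of `𝓑`. -/
def crossingClasses (𝓑 : Set (Set E)) : Set (Set (Set E)) :=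
  {V | ∃ C ∈ (crossingSetoid 𝓑).classes, V = Subtype.val '' C}

/-- A pre-flower of `𝓑`: a finite subset of `𝓑` with at least two elements, any two of which are
linked by a finite sequence in the subset whose consecutive elements cross. -/
def IsPreFlower (𝓑 F : Set (Set E)) : Prop :=
  F ⊆ 𝓑 ∧ F.Finite ∧ F.Nontrivial ∧
    ∀ S ∈ F, ∀ T ∈ F, Relation.ReflTransGen (fun R R' => R ∈ F ∧ R' ∈ F ∧ Crosses R R') S T

/-- `e` and `f` are equivalent if no element of `S` distinguishes them. -/
def indistinguishable (S : Set (Set E)) : Setoid E where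
  r e f := ∀ A ∈ S, e ∈ A ↔ f ∈ A
  iseqv :=
    { refl := fun _ _ _ => Iff.rfl
      symm := fun h A hA => (h A hA).symm
      trans := fun h h' A hA => (h A hA).trans (h' A hA) }

/-- `∂(S)`: the set of equivalence classes of `indistinguishable S`. -/
def boundary (S : Set (Set E)) : Set (Set E) := (indistinguishable S).classes

/-- The closure of `S` in `𝓑`: the elements of `𝓑` that are unions of elements of `∂(S)`. -/
def sepClosure (𝓑 S : Set (Set E)) : Set (Set E) :=
  {A | A ∈ 𝓑 ∧ ∃ C : Set (Set E), C ⊆ boundary S ∧ A = ⋃₀ C}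

/-- Intervals of a cyclically ordered set `X`: with any two points they contain one of the two arcs
between these points. These are `∅`, `X`, and the sets of points between two cuts of `X`; an
interval need not have end points in `X`. -/
def IsInterval {X : Type*} (c : CircularOrder X) (I : Set X) : Prop :=
  ∀ x ∈ I, ∀ y ∈ I, (∀ z, c.sbtw x z y → z ∈ I) ∨ (∀ z, c.sbtw y z x → z ∈ I)

/-- A pre-daisy of `𝓑`: a pre-flower `F` such that, for some cyclic order on `∂(F)`, the elements of
its closure are exactly the unions of non-trivial intervals of `∂(F)`. -/
def IsPreDaisy (𝓑 F : Set (Set E)) : Prop :=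
  IsPreFlower 𝓑 F ∧ ∃ c : CircularOrder ↥(boundary F), ∀ A : Set E,
    A ∈ sepClosure 𝓑 F ↔
      ∃ I : Set ↥(boundary F), IsInterval c I ∧ I ≠ ∅ ∧ I ≠ Set.univ ∧ A = ⋃ P ∈ I, (P : Set E)

/-- Every element of the closure of `V` is the union of an interval of the cyclic order `c`. -/
def Displays (𝓑 V : Set (Set E)) (c : CircularOrder ↥(boundary V)) : Prop :=
  ∀ A ∈ sepClosure 𝓑 V, ∃ I : Set ↥(boundary V), IsInterval c I ∧ A = ⋃ P ∈ I, (P : Set E)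

end BipartitionSystem

/-! In a daisy order on a finite pre-flower `F`, every non-empty open arc between two points is an
element of the closure. Any cyclic order that displays the closure of a larger set must respect all
these arcs, so it agrees with the daisy order up to one global mirroring
(`IsDaisyOrder.sbtw_of_sbtw`). Three points `p, q, r` separated by a crossing pair fix the
mirroring. Pre-flowers are cofinal among the finite subsets of `V`, so the normalised daisy orders
are compatible and have a limit on `∂(V)`. Every displaying order extends them up to mirroring,
which gives uniqueness.

That the limit displays `cl(V)` is not a finite statement, since an element `A` of the closure may
be a union of infinitely many classes. But if `A` is not an interval, it crosses some arc of a
pre-flower, and this arc lies in `V`. Hence `A ∈ V`, and a pre-flower containing `A` gives a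
contradiction. -/

namespace BipartitionSystem

/-! ### Cyclic orders, arcs and intervals. -/

section CyclicOrder

variable {X : Type*}

theorem sbtw_rotate (c : CircularOrder X) {x y z : X} (h : c.sbtw x y z) : c.sbtw y z x :=
  let := c; SBtw.sbtw.cyclic_left h

theorem sbtw_asymm (c : CircularOrder X) {x y z : X} (h : c.sbtw x y z) : ¬ c.sbtw z y x :=
  let := c; SBtw.sbtw.not_sbtw h

theorem sbtw_trans (c : CircularOrder X) {x y z w : X} (h : c.sbtw x y z) (h' : c.sbtw x z w) :
    c.sbtw x y w :=
  let := c
  ((SBtw.sbtw.trans_left (sbtw_rotate c h) (sbtw_rotate c h')).cyclic_left).cyclic_left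

theorem sbtw_total (c : CircularOrder X) {x y z : X} (h₁ : x ≠ y) (h₂ : y ≠ z) (h₃ : z ≠ x) :
    c.sbtw x y z ∨ c.sbtw z y x := by
  let := c
  by_contra! h
  have h1 : btw z y x := by
    by_contra hn
    exact h.1 (sbtw_iff_not_btw.2 hn)
  have h2 : btw x y z := by
    by_contra hn
    exact h.2 (sbtw_iff_not_btw.2 hn)
  rcases Btw.btw.antisymm h2 h1 with h | h | h
  exacts [h₁ h, h₂ h, h₃ h]

theorem sbtw_ne (c : CircularOrder X) {x y z : X} (h : c.sbtw x y z) : x ≠ y ∧ y ≠ z ∧ z ≠ x := by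
  refine ⟨?_, ?_, ?_⟩ <;> rintro rfl
  · exact sbtw_asymm c (sbtw_rotate c h) (sbtw_rotate c h)
  · exact sbtw_asymm c (sbtw_rotate c (sbtw_rotate c h)) (sbtw_rotate c (sbtw_rotate c h))
  · exact sbtw_asymm c h h

/-- A cyclic order given by its strict betweenness relation. -/
@[reducible] def circularOrderOfStrict (T : X → X → X → Prop)
    (rotate : ∀ x y z, T x y z → T y z x) (asymm : ∀ x y z, T x y z → ¬ T z y x)
    (trans : ∀ x y z w, T x y z → T x z w → T x y w)
    (total : ∀ x y z, x ≠ y → y ≠ z → z ≠ x → T x y z ∨ T z y x) : CircularOrder X where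
  btw a b c := ¬ T c b a
  sbtw a b c := T a b c
  btw_refl a h := asymm _ _ _ h h
  btw_cyclic_left h h' := h (rotate _ _ _ h')
  sbtw_trans_left {a b c d} h h' :=
    rotate _ _ _
      (trans _ _ _ _ (rotate _ _ _ (rotate _ _ _ h)) (rotate _ _ _ (rotate _ _ _ h')))
  sbtw_iff_btw_not_btw {a b c} := ⟨fun h => ⟨asymm _ _ _ h, not_not.2 h⟩, fun h => not_not.1 h.2⟩
  btw_antisymm {a b c} h h' := by
    by_contra! hn
    rcases total a b c hn.1 hn.2.1 hn.2.2 with h1 | h1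
    exacts [h' h1, h h1]
  btw_total a b c := by
    by_contra! h
    exact asymm _ _ _ h.1 h.2

/-- The mirror image of a cyclic order. -/
@[reducible] def mirror (c : CircularOrder X) : CircularOrder X :=
  circularOrderOfStrict (fun x y z => c.sbtw z y x)
    (fun _ _ _ h => sbtw_rotate c (sbtw_rotate c h))
    (fun _ _ _ h => sbtw_asymm c h)
    (fun _ _ _ _ h h' => let := c; SBtw.sbtw.trans_left h' h)
    (fun _ _ _ h₁ h₂ h₃ => (sbtw_total c h₁ h₂ h₃).symm)

theorem isInterval_mirror {c : CircularOrder X} {I : Set X} (h : IsInterval c I) :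
    IsInterval (mirror c) I := fun x hx y hy => (h x hx y hy).symm

theorem isInterval_arc (c : CircularOrder X) (u v : X) : IsInterval c {t | c.sbtw u t v} := by
  intro x hx y hy
  simp only [Set.mem_ofPred_eq] at hx hy ⊢
  have r := @sbtw_rotate X c
  have t := @sbtw_trans X c
  have key : ∀ x y, c.sbtw u x v → c.sbtw u y v → c.sbtw u x y →
      ∀ z, c.sbtw x z y → c.sbtw u z v := by
    intro x y _ hy hxy z hz
    have h1 : c.sbtw y x z := r (r hz)
    have h2 : c.sbtw y u x := r (r hxy)
    exact t (r (t h2 h1)) hy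
  by_cases hxy : x = y
  · subst hxy
    exact Or.inl fun z hz => absurd rfl (sbtw_ne c hz).2.2
  · rcases sbtw_total c (sbtw_ne c hx).1 hxy (sbtw_ne c hy).1.symm with h | h
    · exact Or.inl (key x y hx hy h)
    · exact Or.inr (key y x hy hx (r (r h)))

/-- One of the two arcs joining `z` and `w` lies inside the interval, so `z` can be moved to `w`
without passing `x` or `y`. -/
theorem IsInterval.sbtw_of_sbtw {c : CircularOrder X} {I : Set X} (hI : IsInterval c I) {x y z w : X}
    (hx : x ∉ I) (hy : y ∉ I) (hz : z ∈ I) (hw : w ∈ I) (h : c.sbtw x y z) : c.sbtw x y w := by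
  have r := @sbtw_rotate X c
  have t := @sbtw_trans X c
  by_contra hn
  have hxw : x ≠ w := fun h => hx (h ▸ hw)
  have hyw : y ≠ w := fun h => hy (h ▸ hw)
  have h' : c.sbtw w y x := (sbtw_total c (sbtw_ne c h).1 hyw hxw.symm).resolve_left hn
  rcases hI z hz w hw with h1 | h1
  · exact hx (h1 x (r (r (t (r (r h')) h))))
  · exact hy (h1 y (r (r (t (r h) (r h')))))

/-- A rotation invariant property of triples which does not change between positively oriented
triples that share their first two points is the same for all positively oriented triples. -/
theorem sbtw_propagate (c : CircularOrder X) {α : Type*} (π : α → X) (P : α → α → α → Prop)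
    (hP : ∀ x y z, P x y z → P y z x)
    (H : ∀ x y z w, c.sbtw (π x) (π y) (π z) → c.sbtw (π x) (π y) (π w) → P x y z → P x y w)
    {p q r x y z : α} (h : c.sbtw (π p) (π q) (π r)) (h' : c.sbtw (π x) (π y) (π z))
    (hp : P p q r) : P x y z := by
  have ro := @sbtw_rotate X c
  have tr := @sbtw_trans X c
  -- For `w` on the other side of `y`, two exchanges suffice: `y` by `w` with `z, x` kept, then `z`
  -- by `y` with `x, w` kept.
  have opp : ∀ x y z w, c.sbtw (π x) (π y) (π z) → c.sbtw (π x) (π w) (π y) →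
      P x y z → P x w y := by
    intro x y z w h1 h2 h3
    have h4 := tr h2 h1
    have h5 : P z x w := H _ _ _ _ (ro (ro h1)) (ro (ro h4)) (hP _ _ _ (hP _ _ _ h3))
    exact H _ _ _ _ h4 h2 (hP _ _ _ h5)
  -- `Q` ignores orientation, so `p, q, r` can be turned into `x, y, z` by exchanging one point at a
  -- time.
  let Q : α → α → α → Prop := fun x y z =>
    (c.sbtw (π x) (π y) (π z) ∧ P x y z) ∨ (c.sbtw (π z) (π y) (π x) ∧ P z y x)
  have rot : ∀ x y z, Q x y z → Q y z x := by
    rintro x y z (⟨h1, h2⟩ | ⟨h1, h2⟩)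
    · exact Or.inl ⟨ro h1, hP _ _ _ h2⟩
    · exact Or.inr ⟨ro (ro h1), hP _ _ _ (hP _ _ _ h2)⟩
  have swap : ∀ x y z, Q x y z → Q z y x := fun x y z h => Or.symm h
  have pos : ∀ x y z w, π w ≠ π x → π w ≠ π y → c.sbtw (π x) (π y) (π z) → P x y z →
      Q x y w := by
    intro x y z w hx hy h1 h2
    rcases sbtw_total c (sbtw_ne c h1).1 hy.symm hx with h3 | h3
    · exact Or.inl ⟨h3, H _ _ _ _ h1 h3 h2⟩
    · exact Or.inr ⟨h3, hP _ _ _ (opp _ _ _ _ h1 (ro (ro h3)) h2)⟩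
  have step : ∀ x y z w, π w ≠ π x → π w ≠ π y → Q x y z → Q x y w := by
    rintro x y z w hx hy (⟨h1, h2⟩ | ⟨h1, h2⟩)
    · exact pos x y z w hx hy h1 h2
    · exact rot _ _ _ (swap _ _ _ (pos y x z w hy hx (ro h1) (hP _ _ _ h2)))
  obtain ⟨hxy, hyz, hzx⟩ := sbtw_ne c h'
  obtain ⟨hpq, hqr, hrp⟩ := sbtw_ne c h
  have h1 : ∃ a b, π a ≠ π b ∧ π a ≠ π x ∧ π b ≠ π x ∧ Q a b x := by
    have hQ : Q p q r := Or.inl ⟨h, hp⟩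
    by_cases e1 : π x = π p
    · exact ⟨q, r, hqr, by rw [e1]; exact hpq.symm, by rw [e1]; exact hrp,
        step _ _ _ _ (by rw [e1]; exact hpq) (by rw [e1]; exact hrp.symm) (rot _ _ _ hQ)⟩
    · by_cases e2 : π x = π q
      · exact ⟨r, p, hrp, by rw [e2]; exact hqr.symm, by rw [e2]; exact hpq,
          step _ _ _ _ (by rw [e2]; exact hqr) e1 (rot _ _ _ (rot _ _ _ hQ))⟩
      · exact ⟨p, q, hpq, Ne.symm e1, Ne.symm e2, step _ _ _ _ e1 e2 hQ⟩
  obtain ⟨a, b, hab, hax, hbx, hQ⟩ := h1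
  have h2 : ∃ a, Q x y a := by
    by_cases e : π y = π a
    · exact ⟨b, rot _ _ _ (step _ _ _ _ (by rw [e]; exact hab) hxy.symm (rot _ _ _ hQ))⟩
    · exact ⟨a, rot _ _ _ (swap _ _ _ (rot _ _ _ (rot _ _ _
        (step _ _ _ _ hxy.symm e (rot _ _ _ (rot _ _ _ hQ))))))⟩
  obtain ⟨a, hQ⟩ := h2
  rcases step _ _ _ _ hzx hyz.symm hQ with ⟨_, h3⟩ | ⟨h3, _⟩
  · exact h3
  · exact absurd h3 (sbtw_asymm c h')

end CyclicOrder

variable {E : Type*}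

/-! ### Classes of indistinguishable points, closures and daisy orders. -/

section Boundary

/-- The element of `∂(S)` that contains the point `x`. -/
def cls (S : Set (Set E)) (x : E) : ↥(boundary S) :=
  ⟨{y | indistinguishable S y x}, Setoid.mem_classes _ x⟩

theorem cls_eq_cls {S : Set (Set E)} {x y : E} :
    cls S x = cls S y ↔ ∀ A ∈ S, x ∈ A ↔ y ∈ A := by
  constructor
  · intro h
    have : x ∈ (cls S y : Set E) := h ▸ (indistinguishable S).refl x
    exact this
  · intro h
    apply Subtype.ext
    ext z
    exact ⟨fun hz => (indistinguishable S).trans hz h,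
      fun hz => (indistinguishable S).trans hz ((indistinguishable S).symm h)⟩

theorem cls_surjective (S : Set (Set E)) : Function.Surjective (cls S) := by
  rintro ⟨P, x, rfl⟩
  exact ⟨x, rfl⟩

theorem cls_eq_of_mem {S : Set (Set E)} {P : ↥(boundary S)} {x : E} (h : x ∈ (P : Set E)) :
    cls S x = P := by
  obtain ⟨y, rfl⟩ := cls_surjective S P
  exact cls_eq_cls.2 h

theorem mem_cls (S : Set (Set E)) (x : E) : x ∈ (cls S x : Set E) := (indistinguishable S).refl x

theorem cls_eq_cls_of_subset {S S' : Set (Set E)} (h : S ⊆ S') {x y : E}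
    (hxy : cls S' x = cls S' y) : cls S x = cls S y :=
  cls_eq_cls.2 fun A hA => cls_eq_cls.1 hxy A (h hA)

theorem mem_iUnion_boundary {S : Set (Set E)} {I : Set ↥(boundary S)} {x : E} :
    x ∈ ⋃ P ∈ I, (P : Set E) ↔ cls S x ∈ I := by
  simp only [Set.mem_iUnion, exists_prop]
  constructor
  · rintro ⟨P, hP, hx⟩
    rwa [cls_eq_of_mem hx]
  · exact fun h => ⟨_, h, mem_cls S x⟩

theorem mem_sepClosure {𝓑 S : Set (Set E)} {A : Set E} :
    A ∈ sepClosure 𝓑 S ↔ A ∈ 𝓑 ∧ ∀ x y, cls S x = cls S y → x ∈ A → y ∈ A := by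
  refine and_congr_right fun _ => ⟨?_, fun h => ?_⟩
  · rintro ⟨C, hC, rfl⟩ x y hxy ⟨P, hP, hx⟩
    refine ⟨P, hP, ?_⟩
    have h1 : cls S x = ⟨P, hC hP⟩ := cls_eq_of_mem hx
    have h2 : (cls S y : Set E) = P := by rw [← hxy, h1]
    exact h2 ▸ mem_cls S y
  · refine ⟨{P | P ∈ boundary S ∧ P ⊆ A}, fun P hP => hP.1, ?_⟩
    ext x
    constructor
    · intro hx
      exact ⟨cls S x, ⟨(cls S x).2, fun y hy => h x y (cls_eq_of_mem hy).symm hx⟩, mem_cls S x⟩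
    · rintro ⟨P, hP, hx⟩
      exact hP.2 hx

theorem sepClosure_mono {𝓑 S S' : Set (Set E)} (h : S ⊆ S') : sepClosure 𝓑 S ⊆ sepClosure 𝓑 S' :=
  fun _ hA => mem_sepClosure.2 ⟨(mem_sepClosure.1 hA).1, fun x y hxy =>
    (mem_sepClosure.1 hA).2 x y (cls_eq_cls_of_subset h hxy)⟩

theorem subset_sepClosure {𝓑 S : Set (Set E)} (h : S ⊆ 𝓑) : S ⊆ sepClosure 𝓑 S :=
  fun A hA => mem_sepClosure.2 ⟨h hA, fun _ _ hxy hx => (cls_eq_cls.1 hxy A hA).1 hx⟩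

/-- `c` is a cyclic order on `∂(F)` whose non-trivial intervals are the elements of the closure. -/
def IsDaisyOrder (𝓑 F : Set (Set E)) (c : CircularOrder ↥(boundary F)) : Prop :=
  ∀ A : Set E, A ∈ sepClosure 𝓑 F ↔
    ∃ I : Set ↥(boundary F), IsInterval c I ∧ I ≠ ∅ ∧ I ≠ Set.univ ∧ A = ⋃ P ∈ I, (P : Set E)

theorem IsDaisyOrder.displays {𝓑 F : Set (Set E)} {c : CircularOrder ↥(boundary F)}
    (h : IsDaisyOrder 𝓑 F c) : Displays 𝓑 F c := fun A hA => by
  obtain ⟨I, hI, _, _, hA⟩ := (h A).1 hA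
  exact ⟨I, hI, hA⟩

theorem IsDaisyOrder.mirror {𝓑 F : Set (Set E)} {c : CircularOrder ↥(boundary F)}
    (h : IsDaisyOrder 𝓑 F c) : IsDaisyOrder 𝓑 F (mirror c) := by
  intro A
  rw [h A]
  refine exists_congr fun I => and_congr_left fun _ => ⟨isInterval_mirror, fun hI => ?_⟩
  exact fun x hx y hy => (hI x hx y hy).symm

theorem Displays.sbtw_of_sbtw {𝓑 S : Set (Set E)} {c : CircularOrder ↥(boundary S)}
    (h : Displays 𝓑 S c) {A : Set E} (hA : A ∈ sepClosure 𝓑 S) {x y z w : E}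
    (hx : x ∉ A) (hy : y ∉ A) (hz : z ∈ A) (hw : w ∈ A)
    (hc : c.sbtw (cls S x) (cls S y) (cls S z)) : c.sbtw (cls S x) (cls S y) (cls S w) := by
  obtain ⟨I, hI, rfl⟩ := h A hA
  rw [mem_iUnion_boundary] at hx hy hz hw
  exact hI.sbtw_of_sbtw hx hy hz hw hc

theorem IsDaisyOrder.exists_arc {𝓑 F : Set (Set E)} {c : CircularOrder ↥(boundary F)}
    (h : IsDaisyOrder 𝓑 F c) {u v t : E} (ht : c.sbtw (cls F u) (cls F t) (cls F v)) :
    ∃ A ∈ sepClosure 𝓑 F, ∀ x, x ∈ A ↔ c.sbtw (cls F u) (cls F x) (cls F v) := by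
  refine ⟨_, (h _).2 ⟨_, isInterval_arc c (cls F u) (cls F v), ?_, ?_, rfl⟩,
    fun x => mem_iUnion_boundary⟩
  · exact Set.Nonempty.ne_empty ⟨_, ht⟩
  · intro hu
    have : cls F u ∈ {t | c.sbtw (cls F u) t (cls F v)} := hu ▸ Set.mem_univ _
    exact (sbtw_ne c this).1 rfl

/-- If the closure of a daisy is displayed by another cyclic order, the two orders agree up to
mirroring on the points of the daisy. -/
theorem IsDaisyOrder.sbtw_of_sbtw {𝓑 F S : Set (Set E)} {c : CircularOrder ↥(boundary F)}
    {c' : CircularOrder ↥(boundary S)} (hFS : F ⊆ S) (h : IsDaisyOrder 𝓑 F c)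
    (h' : Displays 𝓑 S c') {p q r x y z : E}
    (hp : c.sbtw (cls F p) (cls F q) (cls F r)) (hx : c.sbtw (cls F x) (cls F y) (cls F z))
    (hp' : c'.sbtw (cls S p) (cls S q) (cls S r)) :
    c'.sbtw (cls S x) (cls S y) (cls S z) := by
  refine sbtw_propagate c (cls F) (fun x y z => c'.sbtw (cls S x) (cls S y) (cls S z))
    (fun _ _ _ h => sbtw_rotate c' h) ?_ hp hx hp'
  intro x y z w h1 h2 h3
  have h1' := sbtw_rotate c h1
  -- The open arc from `y` to `x` contains `z` and `w` but neither of its ends, and `c'` displays it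
  -- as an interval.
  obtain ⟨A, hA, hAm⟩ := h.exists_arc h1'
  refine h'.sbtw_of_sbtw (sepClosure_mono hFS hA) ?_ ?_ ((hAm z).2 h1')
    ((hAm w).2 (sbtw_rotate c h2)) h3 <;> rw [hAm] <;> intro hn
  · exact (sbtw_ne c hn).2.1 rfl
  · exact (sbtw_ne c hn).1 rfl

end Boundary

/-! ### Crossing classes and pre-flowers. -/

section Crossing

theorem Nested.symm {A B : Set E} (h : Nested A B) : Nested B A := by
  rcases h with h | h | h | h
  · exact Or.inr (Or.inr (Or.inl h))
  · exact Or.inr (Or.inl (by rwa [Set.inter_comm]))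
  · exact Or.inl h
  · exact Or.inr (Or.inr (Or.inr (by rwa [Set.union_comm])))

theorem Crosses.symm {A B : Set E} (h : Crosses A B) : Crosses B A := fun hn => h hn.symm

theorem crosses_iff {A B : Set E} : Crosses A B ↔
    (∃ x, x ∈ A ∧ x ∉ B) ∧ (∃ x, x ∈ A ∧ x ∈ B) ∧ (∃ x, x ∉ A ∧ x ∈ B) ∧ ∃ x, x ∉ A ∧ x ∉ B := by
  unfold Crosses Nested
  simp only [Set.subset_def, Set.eq_empty_iff_forall_notMem, Set.eq_univ_iff_forall,
    Set.mem_inter_iff, Set.mem_union]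
  push Not
  simp only [and_comm]

/-- A set that is nested with all elements of a crossing-connected set cannot have both its two
sides divided by this set. -/
theorem exists_crosses_of_divided {F : Set (Set E)}
    (hF : ∀ S ∈ F, ∀ T ∈ F,
      Relation.ReflTransGen (fun R R' => R ∈ F ∧ R' ∈ F ∧ Crosses R R') S T)
    {K : Set E} {x z y w : E} (hx : x ∈ K) (hz : z ∈ K) (hy : y ∉ K) (hw : w ∉ K)
    (hxz : cls F x ≠ cls F z) (hyw : cls F y ≠ cls F w) : ∃ R ∈ F, Crosses K R := by
  by_contra! hn
  have hn : ∀ R ∈ F, Nested K R := fun R hR => not_not.1 (hn R hR)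
  simp only [ne_eq, cls_eq_cls, not_forall] at hxz hyw
  obtain ⟨S, hS, hxz⟩ := hxz
  obtain ⟨T, hT, hyw⟩ := hyw
  -- Having a side inside `K` passes along crossings: if `R'` crosses `R`, both sides of `R` meet
  -- both `R'` and its complement, which leaves only the nestings that put a side of `R'` inside
  -- `K`. It holds for `S`, which divides `K`, and it prevents `T` from dividing the complement of
  -- `K`.
  have key : T ⊆ K ∨ Tᶜ ⊆ K := by
    refine (hF S hS T hT).head_induction_on (motive := fun R _ => (R ⊆ K ∨ Rᶜ ⊆ K) →
      (T ⊆ K ∨ Tᶜ ⊆ K)) id ?_ ?_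
    · rintro R R' ⟨_, hR', hc⟩ _ ih h
      apply ih
      obtain ⟨⟨a, ha, ha'⟩, ⟨b, hb, hb'⟩, ⟨d, hd, hd'⟩, e, he, he'⟩ := crosses_iff.1 hc
      rcases hn R' hR' with h1 | h1 | h1 | h1
      · rcases h with h | h
        · exact absurd (h1 (h ha)) ha'
        · exact absurd (h1 (h he)) he'
      · rcases h with h | h
        · exact absurd h1 (Set.Nonempty.ne_empty ⟨b, h hb, hb'⟩)
        · exact absurd h1 (Set.Nonempty.ne_empty ⟨d, h hd, hd'⟩)
      · exact Or.inl h1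
      · exact Or.inr fun t ht => (h1 ▸ Set.mem_univ t : t ∈ K ∪ R').resolve_right ht
    · rcases hn S hS with h1 | h1 | h1 | h1
      · exact absurd (iff_of_true (h1 hx) (h1 hz)) hxz
      · exact absurd (iff_of_false (fun h => (h1 ▸ ⟨hx, h⟩ : x ∈ (∅ : Set E)))
          (fun h => (h1 ▸ ⟨hz, h⟩ : z ∈ (∅ : Set E)))) hxz
      · exact Or.inl h1
      · exact Or.inr fun t ht => (h1 ▸ Set.mem_univ t : t ∈ K ∪ S).resolve_right ht
  rcases key with h | h
  · exact hyw (iff_of_false (fun hh => hy (h hh)) (fun hh => hw (h hh)))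
  · exact hyw (iff_of_true (by_contra fun hh => hy (h hh)) (by_contra fun hh => hw (h hh)))

theorem mem_of_crosses {𝓑 V : Set (Set E)} (hV : V ∈ crossingClasses 𝓑) {S T : Set E}
    (hS : S ∈ V) (hT : T ∈ 𝓑) (h : Crosses S T) : T ∈ V := by
  obtain ⟨C, ⟨a, rfl⟩, rfl⟩ := hV
  obtain ⟨⟨S, hSB⟩, hSa, rfl⟩ := hS
  have hTB : T ∈ 𝓑 \ uncrossed 𝓑 := ⟨hT, fun hu => h (hu.2 S hSB.1).symm⟩
  refine ⟨⟨T, hTB⟩, ?_, rfl⟩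
  refine (crossingSetoid 𝓑).trans ?_ hSa
  intro r hr
  exact r.symm (hr _ _ h)

theorem crossingClass_subset {𝓑 V : Set (Set E)} (hV : V ∈ crossingClasses 𝓑) : V ⊆ 𝓑 := by
  obtain ⟨C, _, rfl⟩ := hV
  rintro _ ⟨S, _, rfl⟩
  exact S.2.1

theorem exists_crosses {𝓑 V : Set (Set E)} (hV : V ∈ crossingClasses 𝓑) :
    ∃ S ∈ V, ∃ T ∈ V, Crosses S T := by
  have hV' := hV
  obtain ⟨C, ⟨a, rfl⟩, rfl⟩ := hV
  have ha : (a : Set E) ∈ Subtype.val '' {x | crossingSetoid 𝓑 x a} :=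
    ⟨a, (crossingSetoid 𝓑).refl a, rfl⟩
  have h := a.2.2
  simp only [uncrossed, Set.mem_ofPred_eq, not_and, not_forall] at h
  obtain ⟨T, hT, hc⟩ := h a.2.1
  exact ⟨a, ha, T, mem_of_crosses hV' ha hT hc, hc⟩

/-- Linkage by crossings inside `V`, extended trivially outside `V`, is an equivalence relation that
relates crossing elements, so the finest such relation is contained in it. -/
theorem crossingClass_connected {𝓑 V : Set (Set E)} (hV : V ∈ crossingClasses 𝓑) {S T : Set E}
    (hS : S ∈ V) (hT : T ∈ V) :
    Relation.ReflTransGen (fun R R' => R ∈ V ∧ R' ∈ V ∧ Crosses R R') S T := by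
  let r := fun R R' : Set E => R ∈ V ∧ R' ∈ V ∧ Crosses R R'
  have hr : Std.Symm r := ⟨fun R R' h => ⟨h.2.1, h.1, h.2.2.symm⟩⟩
  let s : Setoid ↥(𝓑 \ uncrossed 𝓑) :=
    { r := fun A B => ((A : Set E) ∈ V ↔ (B : Set E) ∈ V) ∧
        ((A : Set E) ∈ V → Relation.ReflTransGen r A B)
      iseqv :=
        { refl := fun A => ⟨Iff.rfl, fun _ => .refl⟩
          symm := fun h => ⟨h.1.symm, fun hB => Std.Symm.symm _ _ (h.2 (h.1.2 hB))⟩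
          trans := fun h h' => ⟨h.1.trans h'.1, fun hA => (h.2 hA).trans (h'.2 (h.1.1 hA))⟩ } }
  have hs : ∀ A B, crossingSetoid 𝓑 A B → s A B := by
    intro A B h
    refine h s fun A B hAB => ?_
    have h1 : (A : Set E) ∈ V → (B : Set E) ∈ V := fun h => mem_of_crosses hV h B.2.1 hAB
    have h2 : (B : Set E) ∈ V → (A : Set E) ∈ V := fun h => mem_of_crosses hV h A.2.1 hAB.symm
    exact ⟨⟨h1, h2⟩, fun hA => .single ⟨hA, h1 hA, hAB⟩⟩
  have hV' := hV
  obtain ⟨C, ⟨a, rfl⟩, hVC⟩ := hV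
  have hS' := hS
  rw [hVC] at hS' hT
  obtain ⟨A, hA, rfl⟩ := hS'
  obtain ⟨B, hB, rfl⟩ := hT
  exact (hs A B ((crossingSetoid 𝓑).trans hA ((crossingSetoid 𝓑).symm hB))).2 hS

/-- Every finite subset of a crossing class is contained in a pre-flower inside this class. -/
theorem exists_preFlower {𝓑 V : Set (Set E)} (hV : V ∈ crossingClasses 𝓑) {G : Set (Set E)}
    (hG : G.Finite) (hGV : G ⊆ V) : ∃ F, G ⊆ F ∧ F ⊆ V ∧ IsPreFlower 𝓑 F := by
  obtain ⟨S₀, hS₀, T₀, hT₀, hc⟩ := exists_crosses hV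
  let r := fun (F : Set (Set E)) (R R' : Set E) => R ∈ F ∧ R' ∈ F ∧ Crosses R R'
  -- Keeping the crossing pair `S₀, T₀` makes the set non-trivial; linkage need only be checked from
  -- `S₀`.
  let good : Set (Set E) → Prop := fun F => F ⊆ V ∧ F.Finite ∧ S₀ ∈ F ∧ T₀ ∈ F ∧
    ∀ R ∈ F, Relation.ReflTransGen (r F) S₀ R
  have mono : ∀ {F F'}, F ⊆ F' → ∀ {S T}, Relation.ReflTransGen (r F) S T →
      Relation.ReflTransGen (r F') S T := fun h _ _ h' =>
    Relation.ReflTransGen.mono (fun _ _ hR => ⟨h hR.1, h hR.2.1, hR.2.2⟩) _ _ h'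
  have insert_good : ∀ F, good F → ∀ T ∈ V, ∃ F', good F' ∧ F ⊆ F' ∧ T ∈ F' := by
    intro F hF T hT
    induction crossingClass_connected hV hS₀ hT with
    | refl => exact ⟨F, hF, subset_rfl, hF.2.2.1⟩
    | @tail T T' _ h ih =>
      obtain ⟨F', hF', hsub, hTF⟩ := ih h.1
      have hs : F' ⊆ insert T' F' := Set.subset_insert _ _
      refine ⟨insert T' F', ⟨Set.insert_subset h.2.1 hF'.1, hF'.2.1.insert _, hs hF'.2.2.1,
        hs hF'.2.2.2.1, ?_⟩, hsub.trans hs, Set.mem_insert _ _⟩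
      rintro R (rfl | hR)
      · exact (mono hs (hF'.2.2.2.2 T hTF)).tail ⟨hs hTF, Set.mem_insert _ _, h.2.2⟩
      · exact mono hs (hF'.2.2.2.2 R hR)
  have base : good {S₀, T₀} := by
    refine ⟨Set.pair_subset hS₀ hT₀, by simp, by simp, by simp, ?_⟩
    rintro R (rfl | rfl)
    · exact .refl
    · exact .single ⟨by simp, by simp, hc⟩
  have main : ∃ F, good F ∧ G ⊆ F := by
    induction G, hG using Set.Finite.induction_on with
    | empty => exact ⟨_, base, Set.empty_subset _⟩
    | @insert A G _ _ ih =>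
      obtain ⟨F, hF, hGF⟩ := ih ((Set.subset_insert _ _).trans hGV)
      obtain ⟨F', hF', hsub, hA⟩ := insert_good F hF A (hGV (Set.mem_insert _ _))
      exact ⟨F', hF', Set.insert_subset hA (hGF.trans hsub)⟩
  obtain ⟨F, ⟨h1, h2, h3, h4, h5⟩, hGF⟩ := main
  have hr : Std.Symm (r F) := ⟨fun R R' h => ⟨h.2.1, h.1, h.2.2.symm⟩⟩
  refine ⟨F, hGF, h1, h1.trans (crossingClass_subset hV), h2, ⟨S₀, h3, T₀, h4, ?_⟩, ?_⟩
  · rintro rfl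
    exact hc (Or.inl subset_rfl)
  · exact fun S hS T hT => (Std.Symm.symm _ _ (h5 S hS) :
      Relation.ReflTransGen (r F) S S₀).trans (h5 T hT)

/-- A finite set of points is distinguished by a finite subset as well as by the whole set. -/
theorem exists_finite_distinguishing (V : Set (Set E)) {Y : Set E} (hY : Y.Finite) :
    ∃ G ⊆ V, G.Finite ∧ ∀ x ∈ Y, ∀ y ∈ Y, cls V x ≠ cls V y → cls G x ≠ cls G y := by
  have h : ∀ p : E × E, ∃ G ⊆ V, G.Finite ∧ (cls V p.1 ≠ cls V p.2 → cls G p.1 ≠ cls G p.2) := by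
    intro p
    by_cases hp : cls V p.1 = cls V p.2
    · exact ⟨∅, Set.empty_subset _, Set.finite_empty, fun h => absurd hp h⟩
    · have hp' := hp
      simp only [cls_eq_cls, not_forall] at hp'
      obtain ⟨A, hA, hn⟩ := hp'
      exact ⟨{A}, Set.singleton_subset_iff.2 hA, Set.finite_singleton A,
        fun _ h => hn (cls_eq_cls.1 h A rfl)⟩
  choose G hGV hGf hG using h
  refine ⟨⋃ p ∈ Y ×ˢ Y, G p, Set.iUnion₂_subset fun p _ => hGV p,
    (hY.prod hY).biUnion fun p _ => hGf p, fun x hx y hy hxy h => hG (x, y) hxy ?_⟩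
  exact cls_eq_cls_of_subset (Set.subset_biUnion_of_mem (u := G)
    (show (x, y) ∈ Y ×ˢ Y from ⟨hx, hy⟩)) h

end Crossing

/-! ### The limit of the daisy orders. -/

section Limit

/-- `c` is a daisy order of a finite subset `F` of `V` in which `p, q, r` are positively oriented. -/
def IsOriented (𝓑 V : Set (Set E)) (p q r : E) (F : Set (Set E))
    (c : CircularOrder ↥(boundary F)) : Prop :=
  F ⊆ V ∧ F.Finite ∧ IsDaisyOrder 𝓑 F c ∧ c.sbtw (cls F p) (cls F q) (cls F r)

/-- The points `x, y, z` are positively oriented in some daisy order that orients `p, q, r`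
positively. -/
def LimitSBtw (𝓑 V : Set (Set E)) (p q r x y z : E) : Prop :=
  ∃ F, ∃ c : CircularOrder ↥(boundary F), IsOriented 𝓑 V p q r F c ∧
    c.sbtw (cls F x) (cls F y) (cls F z)

/-- Every pre-flower in `V` has a daisy order. -/
def HasDaisyOrders (𝓑 V : Set (Set E)) : Prop :=
  ∀ F ⊆ V, IsPreFlower 𝓑 F → ∃ c, IsDaisyOrder 𝓑 F c

variable {𝓑 V : Set (Set E)} {p q r : E}

theorem exists_isOriented (hV : V ∈ crossingClasses 𝓑) (hd : HasDaisyOrders 𝓑 V)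
    (hpq : cls V p ≠ cls V q) (hqr : cls V q ≠ cls V r) (hrp : cls V r ≠ cls V p)
    {G : Set (Set E)} (hG : G.Finite) (hGV : G ⊆ V) {Y : Set E} (hY : Y.Finite) :
    ∃ F, ∃ c : CircularOrder ↥(boundary F), G ⊆ F ∧ IsPreFlower 𝓑 F ∧ IsOriented 𝓑 V p q r F c ∧
      ∀ x ∈ Y, ∀ y ∈ Y, cls V x ≠ cls V y → cls F x ≠ cls F y := by
  have hY' : (Y ∪ {p, q, r}).Finite := hY.union (by simp)
  obtain ⟨G', hG'V, hG', hdist⟩ := exists_finite_distinguishing V hY'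
  obtain ⟨F, hF, hFV, hFp⟩ := exists_preFlower hV (hG.union hG') (Set.union_subset hGV hG'V)
  obtain ⟨c, hc⟩ := hd F hFV hFp
  have hdF : ∀ x ∈ Y ∪ {p, q, r}, ∀ y ∈ Y ∪ {p, q, r}, cls V x ≠ cls V y → cls F x ≠ cls F y :=
    fun x hx y hy hxy h => hdist x hx y hy hxy
      (cls_eq_cls_of_subset (Set.subset_union_right.trans hF) h)
  have hdY : ∀ x ∈ Y, ∀ y ∈ Y, cls V x ≠ cls V y → cls F x ≠ cls F y :=
    fun x hx y hy => hdF x (Or.inl hx) y (Or.inl hy)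
  have hGF : G ⊆ F := Set.subset_union_left.trans hF
  rcases sbtw_total c (hdF p (by simp) q (by simp) hpq) (hdF q (by simp) r (by simp) hqr)
    (hdF r (by simp) p (by simp) hrp) with h | h
  · exact ⟨F, c, hGF, hFp, ⟨hFV, hFp.2.1, hc, h⟩, hdY⟩
  · exact ⟨F, mirror c, hGF, hFp, ⟨hFV, hFp.2.1, hc.mirror, h⟩, hdY⟩

/-- If two normalised daisy orders disagreed on a triple, the daisy order of a pre-flower containing
both sets would inherit both orientations. -/
theorem IsOriented.sbtw_of_limitSBtw (hV : V ∈ crossingClasses 𝓑) (hd : HasDaisyOrders 𝓑 V)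
    {F : Set (Set E)} {c : CircularOrder ↥(boundary F)} (h : IsOriented 𝓑 V p q r F c) {x y z : E}
    (hl : LimitSBtw 𝓑 V p q r x y z) (hxy : cls F x ≠ cls F y) (hyz : cls F y ≠ cls F z)
    (hzx : cls F z ≠ cls F x) : c.sbtw (cls F x) (cls F y) (cls F z) := by
  obtain ⟨F', c', ⟨hFV', hF', hc', hp'⟩, hx'⟩ := hl
  obtain ⟨hFV, hF, hc, hp⟩ := h
  rcases sbtw_total c hxy hyz hzx with hx | hx
  · exact hx
  · obtain ⟨h1, h2, h3⟩ := sbtw_ne c hp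
    have hne : ∀ {x y}, cls F x ≠ cls F y → cls V x ≠ cls V y :=
      fun h h' => h (cls_eq_cls_of_subset hFV h')
    obtain ⟨F₁, c₁, hsub, -, ⟨-, -, hc₁, hp₁⟩, -⟩ := exists_isOriented hV hd (hne h1) (hne h2) (hne h3)
      (hF.union hF') (Set.union_subset hFV hFV') Set.finite_empty
    have hs := hc.sbtw_of_sbtw (Set.subset_union_left.trans hsub) hc₁.displays hp hx hp₁
    have hs' := hc'.sbtw_of_sbtw (Set.subset_union_right.trans hsub) hc₁.displays hp' hx' hp₁
    exact absurd hs (sbtw_asymm c₁ hs')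

theorem LimitSBtw.ne {x y z : E} (h : LimitSBtw 𝓑 V p q r x y z) :
    cls V x ≠ cls V y ∧ cls V y ≠ cls V z ∧ cls V z ≠ cls V x := by
  obtain ⟨F, c, ⟨hFV, -⟩, hc⟩ := h
  obtain ⟨h1, h2, h3⟩ := sbtw_ne c hc
  exact ⟨fun h => h1 (cls_eq_cls_of_subset hFV h), fun h => h2 (cls_eq_cls_of_subset hFV h),
    fun h => h3 (cls_eq_cls_of_subset hFV h)⟩

/-- The daisy orders on the finite pre-flowers in `V` have a common extension to `∂(V)`. -/
theorem exists_limit_order (hV : V ∈ crossingClasses 𝓑) (hd : HasDaisyOrders 𝓑 V)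
    (hpq : cls V p ≠ cls V q) (hqr : cls V q ≠ cls V r) (hrp : cls V r ≠ cls V p) :
    ∃ c : CircularOrder ↥(boundary V), ∀ x y z,
      c.sbtw (cls V x) (cls V y) (cls V z) ↔ LimitSBtw 𝓑 V p q r x y z := by
  choose rep hrep using cls_surjective V
  have congr : ∀ {x y z x' y' z'}, cls V x = cls V x' → cls V y = cls V y' → cls V z = cls V z' →
      LimitSBtw 𝓑 V p q r x y z → LimitSBtw 𝓑 V p q r x' y' z' := by
    rintro x y z x' y' z' h1 h2 h3 ⟨F, c, hF, hc⟩
    refine ⟨F, c, hF, ?_⟩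
    rwa [← cls_eq_cls_of_subset hF.1 h1, ← cls_eq_cls_of_subset hF.1 h2,
      ← cls_eq_cls_of_subset hF.1 h3]
  have ne_rep : ∀ {P Q}, P ≠ Q → cls V (rep P) ≠ cls V (rep Q) := fun h => by
    rwa [hrep, hrep]
  refine ⟨circularOrderOfStrict (fun P Q R => LimitSBtw 𝓑 V p q r (rep P) (rep Q) (rep R))
    ?_ ?_ ?_ ?_, fun x y z => ⟨congr (hrep _) (hrep _) (hrep _),
      congr (hrep _).symm (hrep _).symm (hrep _).symm⟩⟩
  · rintro P Q R ⟨F, c, hF, hc⟩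
    exact ⟨F, c, hF, sbtw_rotate c hc⟩
  · rintro P Q R ⟨F, c, hF, hc⟩ h
    obtain ⟨h1, h2, h3⟩ := sbtw_ne c hc
    exact sbtw_asymm c hc (hF.sbtw_of_limitSBtw hV hd h h2.symm h1.symm h3.symm)
  · intro P Q R S h h'
    -- A single pre-flower that separates the four points decides both triples, so transitivity is
    -- inherited from its daisy order.
    obtain ⟨F, c, -, -, hF, hY⟩ := exists_isOriented hV hd hpq hqr hrp Set.finite_empty
      (Set.empty_subset _) (Set.toFinite {rep P, rep Q, rep R, rep S})
    refine ⟨F, c, hF, sbtw_trans c (hF.sbtw_of_limitSBtw hV hd h ?_ ?_ ?_)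
      (hF.sbtw_of_limitSBtw hV hd h' ?_ ?_ ?_)⟩ <;> refine hY _ (by simp) _ (by simp) ?_
    exacts [h.ne.1, h.ne.2.1, h.ne.2.2, h'.ne.1, h'.ne.2.1, h'.ne.2.2]
  · intro P Q R h1 h2 h3
    obtain ⟨F, c, -, -, hF, hY⟩ := exists_isOriented hV hd hpq hqr hrp Set.finite_empty
      (Set.empty_subset _) (Set.toFinite {rep P, rep Q, rep R})
    refine (sbtw_total c ?_ ?_ ?_).imp (fun h => ⟨F, c, hF, h⟩) (fun h => ⟨F, c, hF, h⟩) <;>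
      refine hY _ (by simp) _ (by simp) (ne_rep ?_)
    exacts [h1, h2, h3]

theorem limit_order_displays (hV : V ∈ crossingClasses 𝓑) (hd : HasDaisyOrders 𝓑 V)
    (hpq : cls V p ≠ cls V q) (hqr : cls V q ≠ cls V r) (hrp : cls V r ≠ cls V p)
    {c : CircularOrder ↥(boundary V)}
    (hc : ∀ x y z, c.sbtw (cls V x) (cls V y) (cls V z) ↔ LimitSBtw 𝓑 V p q r x y z) :
    Displays 𝓑 V c := by
  intro A hA
  obtain ⟨hAB, hAV⟩ := mem_sepClosure.1 hA
  refine ⟨{P | ∃ x ∈ A, cls V x = P}, ?_, ?_⟩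
  swap
  · ext x
    rw [mem_iUnion_boundary]
    exact ⟨fun hx => ⟨x, hx, rfl⟩, fun ⟨y, hy, hyx⟩ => hAV y x hyx hy⟩
  rintro _ ⟨x, hx, rfl⟩ _ ⟨y, hy, rfl⟩
  by_contra! hn
  obtain ⟨⟨Z, hxzy, hz⟩, W, hywx, hw⟩ := hn
  obtain ⟨z, rfl⟩ := cls_surjective V Z
  obtain ⟨w, rfl⟩ := cls_surjective V W
  replace hz : z ∉ A := fun h => hz ⟨z, h, rfl⟩
  replace hw : w ∉ A := fun h => hw ⟨w, h, rfl⟩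
  rw [hc] at hxzy hywx
  -- the order of the four points in a sufficiently large pre-flower
  have key : ∀ G : Set (Set E), G.Finite → G ⊆ V → ∃ F, ∃ c : CircularOrder ↥(boundary F),
      G ⊆ F ∧ F ⊆ V ∧ IsPreFlower 𝓑 F ∧ IsDaisyOrder 𝓑 F c ∧
      c.sbtw (cls F x) (cls F z) (cls F y) ∧ c.sbtw (cls F y) (cls F w) (cls F x) := by
    intro G hG hGV
    obtain ⟨F, c', hGF, hFp, hF, hY⟩ := exists_isOriented hV hd hpq hqr hrp hG hGV
      (Set.toFinite {x, y, z, w})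
    refine ⟨F, c', hGF, hF.1, hFp, hF.2.2.1, hF.sbtw_of_limitSBtw hV hd hxzy ?_ ?_ ?_,
      hF.sbtw_of_limitSBtw hV hd hywx ?_ ?_ ?_⟩ <;> refine hY _ (by simp) _ (by simp) ?_
    exacts [hxzy.ne.1, hxzy.ne.2.1, hxzy.ne.2.2, hywx.ne.1, hywx.ne.2.1, hywx.ne.2.2]
  -- The arc `K` from `w` to `y` contains `x, z` and misses `y, w`. As `F` divides both sides of
  -- `K`, some element of `F` crosses `K`, so `K ∈ V`; and `K` crosses `A`.
  have hAV : A ∈ V := by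
    obtain ⟨F, c', -, hFV, hFp, hF, h1, h2⟩ := key ∅ Set.finite_empty (Set.empty_subset _)
    have h3 : c'.sbtw (cls F w) (cls F x) (cls F y) := sbtw_rotate c' h2
    have h4 : c'.sbtw (cls F w) (cls F z) (cls F y) :=
      sbtw_rotate c' (sbtw_trans c' h2 (sbtw_rotate c' (sbtw_rotate c' h1)))
    obtain ⟨K, hK, hKm⟩ := hF.exists_arc h3
    have hyK : y ∉ K := fun h => (sbtw_ne c' ((hKm y).1 h)).2.1 rfl
    have hwK : w ∉ K := fun h => (sbtw_ne c' ((hKm w).1 h)).1 rfl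
    obtain ⟨R, hR, hKR⟩ := exists_crosses_of_divided hFp.2.2.2 ((hKm x).2 h3) ((hKm z).2 h4)
      hyK hwK (sbtw_ne c' h1).1 (sbtw_ne c' h2).1
    have hKV : K ∈ V := mem_of_crosses hV (hFV hR) (mem_sepClosure.1 hK).1 hKR.symm
    refine mem_of_crosses hV hKV hAB (crosses_iff.2
      ⟨⟨z, (hKm z).2 h4, hz⟩, ⟨x, (hKm x).2 h3, hx⟩, ⟨y, hyK, hy⟩, ⟨w, hwK, hw⟩⟩)
  -- Now `A` can be put into the pre-flower, whose daisy order makes it an interval although `z, w ∉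
  -- A` separate `x, y ∈ A`.
  obtain ⟨F, c', hAF, hFV, hFp, hF, h1, h2⟩ := key {A} (Set.finite_singleton A)
    (Set.singleton_subset_iff.2 hAV)
  have hAcl := subset_sepClosure (hFV.trans (crossingClass_subset hV)) (hAF rfl)
  have h5 : c'.sbtw (cls F z) (cls F w) (cls F x) :=
    sbtw_rotate c' (sbtw_trans c' h1 (sbtw_rotate c' (sbtw_rotate c' h2)))
  have h6 := hF.displays.sbtw_of_sbtw hAcl hz hw hx hy h5
  have h7 : c'.sbtw (cls F y) (cls F w) (cls F z) :=
    sbtw_trans c' h2 (sbtw_rotate c' (sbtw_rotate c' h1))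
  exact sbtw_asymm c' h6 h7

end Limit

end BipartitionSystem

/-! ### Existence and uniqueness up to mirroring. -/

theorem mainTheorem11 {E : Type*} (𝓑 : Set (Set E))
    (h_nontrivial : ∀ S ∈ 𝓑, S ≠ ∅ ∧ S ≠ Set.univ)
    (h_compl : ∀ S ∈ 𝓑, Sᶜ ∈ 𝓑)
    (h_union : ∀ S ∈ 𝓑, ∀ T ∈ 𝓑, BipartitionSystem.Crosses S T → S ∪ T ∈ 𝓑)
    (V : Set (Set E)) (hV : V ∈ BipartitionSystem.crossingClasses 𝓑)
    (h_daisy : ∀ F : Set (Set E), F ⊆ V → BipartitionSystem.IsPreFlower 𝓑 F →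
      BipartitionSystem.IsPreDaisy 𝓑 F) :
    ∃ c : CircularOrder ↥(BipartitionSystem.boundary V),
      BipartitionSystem.Displays 𝓑 V c ∧
      ∀ c' : CircularOrder ↥(BipartitionSystem.boundary V),
        BipartitionSystem.Displays 𝓑 V c' →
          (∀ P Q R, c'.sbtw P Q R ↔ c.sbtw P Q R) ∨
          (∀ P Q R, c'.sbtw P Q R ↔ c.sbtw R Q P) := by
  open BipartitionSystem in
  have hd : HasDaisyOrders 𝓑 V := fun F hF hFp => (h_daisy F hF hFp).2
  obtain ⟨S, hS, T, hT, hST⟩ := exists_crosses hV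
  -- Points from three corners of a crossing pair lie in distinct classes and fix the orientation.
  obtain ⟨⟨p, hpS, hpT⟩, ⟨q, hqS, hqT⟩, ⟨r, hrS, hrT⟩, -⟩ := crosses_iff.1 hST
  have hpq : cls V p ≠ cls V q := fun h => hpT ((cls_eq_cls.1 h T hT).2 hqT)
  have hqr : cls V q ≠ cls V r := fun h => hrS ((cls_eq_cls.1 h S hS).1 hqS)
  have hrp : cls V r ≠ cls V p := fun h => hrS ((cls_eq_cls.1 h S hS).2 hpS)
  obtain ⟨c, hc⟩ := exists_limit_order hV hd hpq hqr hrp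
  refine ⟨c, limit_order_displays hV hd hpq hqr hrp hc, fun c' hc' => ?_⟩
  have hpqr : c'.sbtw (cls V p) (cls V q) (cls V r) ∨ c'.sbtw (cls V r) (cls V q) (cls V p) :=
    sbtw_total c' hpq hqr hrp
  -- a displaying order that orients `p, q, r` positively extends `c`
  have key : ∀ c' : CircularOrder ↥(boundary V), Displays 𝓑 V c' →
      c'.sbtw (cls V p) (cls V q) (cls V r) → ∀ P Q R, c'.sbtw P Q R ↔ c.sbtw P Q R := by
    intro c' hc' hp
    have h1 : ∀ P Q R, c.sbtw P Q R → c'.sbtw P Q R := by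
      intro P Q R h
      obtain ⟨x, rfl⟩ := cls_surjective V P
      obtain ⟨y, rfl⟩ := cls_surjective V Q
      obtain ⟨z, rfl⟩ := cls_surjective V R
      obtain ⟨F, cF, ⟨hFV, -, hF, hpF⟩, hx⟩ := (hc x y z).1 h
      exact hF.sbtw_of_sbtw hFV hc' hpF hx hp
    -- Cyclic orders are total, so one that contains another equals it.
    refine fun P Q R => ⟨fun h => ?_, h1 P Q R⟩
    obtain ⟨hPQ, hQR, hRP⟩ := sbtw_ne c' h
    exact (sbtw_total c hPQ hQR hRP).resolve_right fun h' => sbtw_asymm c' h (h1 _ _ _ h')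
  rcases hpqr with h | h
  · exact Or.inl (key c' hc' h)
  · refine Or.inr fun P Q R => key (mirror c') ?_ h R Q P
    intro A hA
    obtain ⟨I, hI, hAI⟩ := hc' A hA
    exact ⟨I, isInterval_mirror hI, hAI⟩
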